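/- A binary tree is either a leaf $\perp$ or a node $L\wedge R$ with a left subtree $L$ and a right subtree $R$; its height is $h(\perp)=0$, $h(L\wedge R)=1+\max(h(L),h(R))$, and it is balanced if $h(R')-h(L')\in\{-1,0,1\}$ for every node, where $L'$ and $R'$ are the left and right subtrees of that node. The Tamari order $\le_{\mathrm T}$ is the reflexive and transitive closure of the right rotation, which replaces a subtree $(A\wedge B)\wedge C$ rooted at a node by $A\wedge(B\wedge C)$. For $n\ge 0$ let $b_n$ be the number of balanced binary tree intervals $[T_0,T_1]$ of trees with $n$ leaves, that is, of pairs $T_0\le_{\mathrm T}T_1$ of balanced binary trees with $n$ leaves (this number is finite). Then there is a unique formal power series $\mathcal S_{\mathrm{bi}}(x,y,z)\in\mathbb Z[[x,y,z]]$ with zero constant term such that $$\mathcal S_{\mathrm{bi}}(x,y,z)=x+\mathcal S_{\mathrm{bi}}(x^2+2xy+yz,\;x,\;x^2+xy),$$ and $$\sum_{n\ge 0} b_n x^n=\mathcal S_{\mathrm{bi}}(x,0,0).$$ -/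

import Mathlib

/-- Complete rooted planar binary trees, i.e. `BinaryTree Unit`: `BinaryTree.nil` is the leaf (the
empty tree). `wedge L R` is the tree with left subtree `L` and right subtree `R`. -/
abbrev wedge (L R : BinaryTree Unit) : BinaryTree Unit := BinaryTree.node () L R

/-- A binary tree is balanced if each of its nodes has an imbalance (height of the right subtree
minus height of the left subtree) in `{-1, 0, 1}`. -/
def IsBalanced : BinaryTree Unit → Prop
  | .nil => True
  | .node _ L R =>
      ((R.height : ℤ) - (L.height : ℤ)) ∈ ({-1, 0, 1} : Set ℤ) ∧ IsBalanced L ∧ IsBalanced R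

/-- `RightRotation T₀ T₁`: the tree `T₁` is obtained from `T₀` by replacing the subtree
`(A ∧ B) ∧ C` rooted at some node of `T₀` by `A ∧ (B ∧ C)`. -/
inductive RightRotation : BinaryTree Unit → BinaryTree Unit → Prop
  | root (A B C : BinaryTree Unit) :
      RightRotation (wedge (wedge A B) C) (wedge A (wedge B C))
  | left {L L' : BinaryTree Unit} (R : BinaryTree Unit) :
      RightRotation L L' → RightRotation (wedge L R) (wedge L' R)
  | right (L : BinaryTree Unit) {R R' : BinaryTree Unit} :
      RightRotation R R' → RightRotation (wedge L R) (wedge L R')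

/-- The Tamari order: the reflexive and transitive closure of right rotation. -/
def TamariLE : BinaryTree Unit → BinaryTree Unit → Prop :=
  Relation.ReflTransGen RightRotation

/-- The intervals `[T₀, T₁]` of the Tamari lattice whose endpoints are balanced binary trees with
`n` leaves, each given by its pair of endpoints. -/
def balancedIntervals (n : ℕ) : Set (BinaryTree Unit × BinaryTree Unit) :=
  {I | I.1.numLeaves = n ∧ I.2.numLeaves = n ∧ IsBalanced I.1 ∧ IsBalanced I.2 ∧
    TamariLE I.1 I.2}

/-- The generating series of balanced binary tree intervals by number of leaves. -/
noncomputable def balancedIntervalSeries : PowerSeries ℤ :=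
  PowerSeries.mk fun n => ((balancedIntervals n).ncard : ℤ)

/-- The substitution `(x, y, z) ↦ (x² + 2xy + yz, x, x² + xy)`,
where `x`, `y`, `z` are the variables `X 0`, `X 1`, `X 2`. -/
noncomputable def biSubst : Fin 3 → MvPowerSeries (Fin 3) ℤ :=
  ![MvPowerSeries.X 0 ^ 2 + 2 * MvPowerSeries.X 0 * MvPowerSeries.X 1
      + MvPowerSeries.X 1 * MvPowerSeries.X 2,
    MvPowerSeries.X 0,
    MvPowerSeries.X 0 ^ 2 + MvPowerSeries.X 0 * MvPowerSeries.X 1]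

/-- The substitution `(x, y, z) ↦ (x, 0, 0)`. -/
noncomputable def specSubst : Fin 3 → PowerSeries ℤ :=
  ![PowerSeries.X, 0, 0]

/-- The formal substitution `biSubst` is legitimate. -/
theorem hasSubst_biSubst : MvPowerSeries.HasSubst biSubst := by
  apply MvPowerSeries.hasSubst_of_constantCoeff_zero
  intro i
  fin_cases i <;> simp [biSubst]

/-- The formal substitution `specSubst` is legitimate. -/
theorem hasSubst_specSubst : MvPowerSeries.HasSubst specSubst := by
  apply MvPowerSeries.hasSubst_of_constantCoeff_zero
  intro i
  fin_cases i
  · exact PowerSeries.constantCoeff_X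
  · simp [specSubst]
  · simp [specSubst]

/-- `S` is a formal power series in `x`, `y`, `z` without constant term such that
`S(x, y, z) = x + S(x² + 2xy + yz, x, x² + xy)`. -/
def IsBiSeries (S : MvPowerSeries (Fin 3) ℤ) : Prop :=
  MvPowerSeries.constantCoeff S = 0 ∧
    S = MvPowerSeries.X 0 + MvPowerSeries.subst biSubst S

/-!
Let `T₀ ≤ T₁` be balanced with `T₁ = L ∧ R`. Undoing rotations, `L` lies above a subtree `P` on
the left spine of `T₀` and `R` above the tree `Q` formed by the right subtrees hanging off the
spine above `P`. Comparing heights, balance forces `P` to have depth one or two, and `T₀` and `T₁`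
to have the same height. So a nontrivial balanced interval is either the wedge of two balanced
intervals, or `[(A₀ ∧ B₀) ∧ C₀, A₁ ∧ (B₁ ∧ C₁)]` with `A`, `C` of the same height and `B` of that
height or one less. If `ℓₖ` denotes the generating series of the balanced intervals of height
`k - 1`, this reads `ℓₖ₊₂ = ℓₖ₊₁² + 2 ℓₖ₊₁ ℓₖ + ℓₖ (ℓₖ² + ℓₖ ℓₖ₋₁)`, so that substituting
`(x, y, z) = (ℓₕ₊₁, ℓₕ, ℓₕ² + ℓₕ ℓₕ₋₁)` into `biSubst` increments `h`; for `h = 0` this is the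
substitution `(x, 0, 0)`.

With weights `2`, `1`, `2`, the substitution `biSubst` raises weighted orders by one, so the
functional equation is a fixed point equation for a contraction. Iterating it and specializing to
`(x, 0, 0)` gives `S(x, 0, 0) = ∑ₕ ℓₕ₊₁`.
-/

section FixedPoint

open MvPowerSeries

variable {σ R : Type*}

theorem eq_of_forall_le_weightedOrder_sub [Ring R] (w : σ → ℕ) {f g : MvPowerSeries σ R}
    (h : ∀ n : ℕ, (n : ℕ∞) ≤ (f - g).weightedOrder w) : f = g :=
  sub_eq_zero.1 ((weightedOrder_eq_top_iff w).1 (ENat.eq_top_iff_forall_ge.2 h))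

theorem exists_forall_le_weightedOrder_sub [Ring R] (w : σ → ℕ) {F : ℕ → MvPowerSeries σ R}
    (hF : ∀ n k : ℕ, (n : ℕ∞) ≤ (F (n + k) - F n).weightedOrder w) :
    ∃ S : MvPowerSeries σ R, ∀ n : ℕ, (n : ℕ∞) ≤ (S - F n).weightedOrder w := by
  let S : MvPowerSeries σ R := fun d => coeff d (F (Finsupp.weight w d + 1))
  have coeff_S (d : σ →₀ ℕ) : coeff d S = coeff d (F (Finsupp.weight w d + 1)) := rfl
  refine ⟨S, fun n => nat_le_weightedOrder w fun d hd => ?_⟩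
  obtain ⟨k, rfl⟩ := Nat.exists_eq_add_of_lt hd
  have stable : coeff d (F (Finsupp.weight w d + 1 + k) - F (Finsupp.weight w d + 1)) = 0 :=
    coeff_eq_zero_of_lt_weightedOrder w
      (lt_of_lt_of_le (by exact_mod_cast Nat.lt_succ_self _) (hF _ k))
  rw [map_sub, sub_eq_zero] at stable
  rw [map_sub, coeff_S, Nat.add_right_comm, stable, sub_self]

theorem le_weightedOrder_sub_C_constantCoeff [Ring R] {w : σ → ℕ} {f : MvPowerSeries σ R} {n : ℕ}
    (hn : (n : ℕ∞) ≤ f.weightedOrder w) :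
    (n : ℕ∞) ≤ (f - C (constantCoeff f)).weightedOrder w := by
  classical
  refine nat_le_weightedOrder w fun d hd => ?_
  rcases eq_or_ne d 0 with rfl | hd0
  · simp
  · rw [map_sub, coeff_C, if_neg hd0, sub_zero]
    exact coeff_eq_zero_of_lt_weightedOrder w (lt_of_lt_of_le (by exact_mod_cast hd) hn)

theorem existsUnique_fixedPoint_of_weightedOrder_lt [Ring R] (w : σ → ℕ)
    {Φ : MvPowerSeries σ R → MvPowerSeries σ R}
    (hΦ : ∀ (f g : MvPowerSeries σ R) (n : ℕ), (n : ℕ∞) ≤ (f - g).weightedOrder w →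
      ((n + 1 : ℕ) : ℕ∞) ≤ (Φ f - Φ g).weightedOrder w) :
    ∃! S, Φ S = S := by
  have iterate_cauchy (n k : ℕ) : (n : ℕ∞) ≤ (Φ^[n + k] 0 - Φ^[n] 0).weightedOrder w := by
    induction n with
    | zero => simp
    | succ n ih =>
      rw [Nat.add_right_comm, Function.iterate_succ_apply', Function.iterate_succ_apply']
      exact hΦ _ _ n ih
  obtain ⟨S, hS⟩ := exists_forall_le_weightedOrder_sub w (F := fun n => Φ^[n] 0) iterate_cauchy
  have hΦS : Φ S = S := by
    refine eq_of_forall_le_weightedOrder_sub w fun n => ?_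
    have hleft : (n : ℕ∞) ≤ (Φ S - Φ^[n + 1] 0).weightedOrder w := by
      rw [Function.iterate_succ_apply']
      exact le_trans (by exact_mod_cast n.le_succ) (hΦ _ _ n (hS n))
    have hright : (n : ℕ∞) ≤ (Φ^[n + 1] 0 - S).weightedOrder w := by
      rw [← neg_sub, weightedOrder_neg]
      exact le_trans (by exact_mod_cast n.le_succ) (hS (n + 1))
    rw [← sub_add_sub_cancel (Φ S) (Φ^[n + 1] 0) S]
    exact (le_min hleft hright).trans (min_weightedOrder_le_add w)
  refine ⟨S, hΦS, fun S' hS' => eq_of_forall_le_weightedOrder_sub w fun n => ?_⟩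
  induction n with
  | zero => simp
  | succ n ih =>
    rw [← hS', ← hΦS]
    exact hΦ _ _ n ih

end FixedPoint

section Substitution

open MvPowerSeries

variable {σ τ R S : Type*} [CommRing R] [CommRing S] [Algebra R S]

theorem add_one_le_weightedOrder_subst {w : σ → ℕ} {v : τ → ℕ} {a : σ → MvPowerSeries τ S}
    (ha : HasSubst a) (haw : ∀ i, ((w i + 1 : ℕ) : ℕ∞) ≤ (a i).weightedOrder v)
    {f : MvPowerSeries σ R} (hf : constantCoeff f = 0) {n : ℕ}
    (hn : (n : ℕ∞) ≤ f.weightedOrder w) :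
    ((n + 1 : ℕ) : ℕ∞) ≤ (subst a f).weightedOrder v := by
  refine le_trans (le_iInf₂ fun d hd => ?_) (le_weightedOrder_subst v ha f)
  have hd0 : d ≠ 0 := by
    rintro rfl
    exact hd hf
  have hweight : n ≤ Finsupp.weight w d := by
    exact_mod_cast hn.trans (weightedOrder_le w hd)
  have hdegree : 1 ≤ d.degree :=
    Nat.one_le_iff_ne_zero.2 fun h => hd0 ((Finsupp.degree_eq_zero_iff d).1 h)
  calc ((n + 1 : ℕ) : ℕ∞)
      ≤ ((Finsupp.weight w d + d.degree : ℕ) : ℕ∞) := by exact_mod_cast add_le_add hweight hdegree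
    _ = ∑ i ∈ d.support, d i • ((w i + 1 : ℕ) : ℕ∞) := by
      simp [Finsupp.weight_apply, Finsupp.sum, Finsupp.degree_apply,
        Finset.sum_add_distrib]
    _ ≤ ∑ i ∈ d.support, d i • (a i).weightedOrder v :=
      Finset.sum_le_sum fun i _ => nsmul_le_nsmul_right (haw i) _

theorem existsUnique_eq_add_subst {w : σ → ℕ} {a : σ → MvPowerSeries σ R} (ha : HasSubst a)
    (haw : ∀ i, ((w i + 1 : ℕ) : ℕ∞) ≤ (a i).weightedOrder w) {f : MvPowerSeries σ R}
    (hf : constantCoeff f = 0) :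
    ∃! S : MvPowerSeries σ R, constantCoeff S = 0 ∧ S = f + subst a S := by
  have ha0 (i : σ) : constantCoeff (a i) = 0 :=
    coeff_eq_zero_of_lt_weightedOrder (d := 0) w (lt_of_lt_of_le (by simp) (haw i))
  -- `S ↦ f + subst a S` is a contraction only up to constant terms, which `subst a` preserves;
  -- subtracting the constant term of `S` makes it one and does not change the solutions.
  let Φ (S : MvPowerSeries σ R) : MvPowerSeries σ R := f + subst a (S - C (constantCoeff S))
  have hΦ_contracting (g h : MvPowerSeries σ R) (n : ℕ) (hn : (n : ℕ∞) ≤ (g - h).weightedOrder w) :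
      ((n + 1 : ℕ) : ℕ∞) ≤ (Φ g - Φ h).weightedOrder w := by
    have hΦ_sub : Φ g - Φ h = subst a (g - h - C (constantCoeff (g - h))) := by
      simp only [Φ, map_sub, subst_sub ha]
      ring
    rw [hΦ_sub]
    exact add_one_le_weightedOrder_subst ha haw (by simp) (le_weightedOrder_sub_C_constantCoeff hn)
  have hΦ_fixed (S : MvPowerSeries σ R) :
      Φ S = S ↔ constantCoeff S = 0 ∧ S = f + subst a S := by
    constructor
    · intro hS
      have hS0 : constantCoeff S = 0 := by
        rw [← hS, map_add, hf, constantCoeff_subst_eq_zero ha ha0 (by simp), add_zero]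
      exact ⟨hS0, by simpa [Φ, hS0] using hS.symm⟩
    · rintro ⟨hS0, hS⟩
      simpa [Φ, hS0] using hS.symm
  simpa only [hΦ_fixed] using existsUnique_fixedPoint_of_weightedOrder_lt w hΦ_contracting

theorem le_order_subst_of_forall_le {a : σ → MvPowerSeries τ S} (ha : HasSubst a) {n : ℕ∞}
    (han : ∀ i, n ≤ (a i).order) {f : MvPowerSeries σ R} (hf : constantCoeff f = 0) :
    n ≤ (subst a f).order :=
  calc n = n * 1 := (mul_one n).symm
    _ ≤ (⨅ i, (a i).order) * f.order :=
      mul_le_mul' (le_iInf han) (one_le_order_iff_constCoeff_eq_zero.2 hf)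
    _ ≤ (subst a f).order := le_order_subst ha f

theorem subst_eq_sum_subst_add_subst {a : σ → MvPowerSeries σ R} (ha : HasSubst a)
    {b : ℕ → σ → MvPowerSeries τ R} (hb : ∀ h, HasSubst (b h))
    (hab : ∀ h i, subst (b h) (a i) = b (h + 1) i) {f g : MvPowerSeries σ R}
    (hg : g = f + subst a g) (n : ℕ) :
    subst (b 0) g = ∑ h ∈ Finset.range n, subst (b h) f + subst (b n) g := by
  have step (h : ℕ) : subst (b h) g = subst (b h) f + subst (b (h + 1)) g := by
    conv_lhs => rw [hg, subst_add (hb h), subst_comp_subst_apply ha (hb h)]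
    simp only [hab]
  induction n with
  | zero => simp
  | succ n ih => rw [ih, step, Finset.sum_range_succ, add_assoc]

theorem coeff_subst_eq_sum_coeff_subst {a : σ → MvPowerSeries σ R} (ha : HasSubst a)
    {b : ℕ → σ → MvPowerSeries τ R} (hb : ∀ h, HasSubst (b h))
    (hab : ∀ h i, subst (b h) (a i) = b (h + 1) i)
    (hbo : ∀ (h : ℕ) (i : σ), (h : ℕ∞) ≤ (b h i).order) {f g : MvPowerSeries σ R}
    (hg0 : constantCoeff g = 0) (hg : g = f + subst a g) (d : τ →₀ ℕ) :
    coeff d (subst (b 0) g) = ∑ h ∈ Finset.range (d.degree + 1), coeff d (subst (b h) f) := by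
  have tail : coeff d (subst (b (d.degree + 1)) g) = 0 :=
    coeff_of_lt_order (lt_of_lt_of_le (by exact_mod_cast Nat.lt_succ_self _)
      (le_order_subst_of_forall_le (hb _) (hbo _) hg0))
  rw [subst_eq_sum_subst_add_subst ha hb hab hg (d.degree + 1), map_add, map_sum, tail, add_zero]

end Substitution

namespace TamariLE

theorem refl (T : BinaryTree Unit) : TamariLE T T :=
  Relation.ReflTransGen.refl

theorem trans {T₀ T₁ T₂ : BinaryTree Unit} (h : TamariLE T₀ T₁) (h' : TamariLE T₁ T₂) :
    TamariLE T₀ T₂ :=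
  Relation.ReflTransGen.trans h h'

theorem wedge_mono {L L' R R' : BinaryTree Unit} (hL : TamariLE L L') (hR : TamariLE R R') :
    TamariLE (wedge L R) (wedge L' R') :=
  trans
    (Relation.ReflTransGen.lift (wedge · R) (fun _ _ h => RightRotation.left R h) _ _ hL)
    (Relation.ReflTransGen.lift (wedge L' ·) (fun _ _ h => RightRotation.right L' h) _ _ hR)

theorem rotate (A B C : BinaryTree Unit) :
    TamariLE (wedge (wedge A B) C) (wedge A (wedge B C)) :=
  Relation.ReflTransGen.single (.root A B C)

end TamariLE

theorem RightRotation.numLeaves_eq {T T' : BinaryTree Unit} (h : RightRotation T T') :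
    T.numLeaves = T'.numLeaves := by
  induction h with
  | root A B C => simp only [BinaryTree.numLeaves, add_assoc]
  | left R _ ih => simp only [BinaryTree.numLeaves, ih]
  | right L _ ih => simp only [BinaryTree.numLeaves, ih]

theorem TamariLE.numLeaves_eq {T T' : BinaryTree Unit} (h : TamariLE T T') :
    T.numLeaves = T'.numLeaves := by
  induction h with
  | refl => rfl
  | tail _ h ih => exact ih.trans h.numLeaves_eq

theorem numLeaves_eq_one_iff {α : Type*} {T : BinaryTree α} : T.numLeaves = 1 ↔ T = .nil := by
  cases T with
  | nil => simp
  | node _ L R =>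
    have hL := L.numLeaves_pos
    have hR := R.numLeaves_pos
    simp only [BinaryTree.numLeaves, reduceCtorEq, iff_false]
    omega

theorem TamariLE.eq_nil_iff {T T' : BinaryTree Unit} (h : TamariLE T T') :
    T = .nil ↔ T' = .nil := by
  rw [← numLeaves_eq_one_iff, ← numLeaves_eq_one_iff, h.numLeaves_eq]

/-- `SpineCut T P Q`: the tree `P` is a proper subtree of `T` rooted at its left spine, say
`T = ((P ∧ S₁) ∧ S₂) ⋯ ∧ Sₖ`, and `Q = (S₁ ∧ S₂) ⋯ ∧ Sₖ`. Rotating `P` up to the root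
shows `T ≤ P ∧ Q`, and every tree `L ∧ R ≥ T` lies above one of these. -/
inductive SpineCut : BinaryTree Unit → BinaryTree Unit → BinaryTree Unit → Prop
  | root (L R : BinaryTree Unit) : SpineCut (wedge L R) L R
  | step {L P Q : BinaryTree Unit} (R : BinaryTree Unit) :
      SpineCut L P Q → SpineCut (wedge L R) P (wedge Q R)

theorem RightRotation.exists_spineCut {T T' P' Q' : BinaryTree Unit} (h : RightRotation T T')
    (h' : SpineCut T' P' Q') : ∃ P Q, SpineCut T P Q ∧ TamariLE P P' ∧ TamariLE Q Q' := by
  induction h generalizing P' Q' with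
  | root A B C =>
    cases h' with
    | root => exact ⟨_, _, .step C (.root A B), .refl _, .refl _⟩
    | step _ h => exact ⟨_, _, .step C (.step B h), .refl _, .rotate _ _ _⟩
  | left R hr ih =>
    cases h' with
    | root => exact ⟨_, _, .root _ R, .single hr, .refl _⟩
    | step _ h =>
      obtain ⟨P, Q, cut, hP, hQ⟩ := ih h
      exact ⟨_, _, .step R cut, hP, hQ.wedge_mono (.refl R)⟩
  | right L hr =>
    cases h' with
    | root => exact ⟨_, _, .root L _, .refl _, .single hr⟩
    | step _ h => exact ⟨_, _, .step _ h, .refl _, .wedge_mono (.refl _) (.single hr)⟩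

theorem TamariLE.exists_spineCut {T L R : BinaryTree Unit} (h : TamariLE T (wedge L R)) :
    ∃ P Q, SpineCut T P Q ∧ TamariLE P L ∧ TamariLE Q R := by
  induction h using Relation.ReflTransGen.head_induction_on with
  | refl => exact ⟨_, _, .root L R, .refl _, .refl _⟩
  | head hr _ ih =>
    obtain ⟨P, Q, cut, hP, hQ⟩ := ih
    obtain ⟨P', Q', cut', hP', hQ'⟩ := hr.exists_spineCut cut
    exact ⟨_, _, cut', hP'.trans hP, hQ'.trans hQ⟩

theorem isBalanced_wedge {L R : BinaryTree Unit} :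
    IsBalanced (wedge L R) ↔ (L.height ≤ R.height + 1 ∧ R.height ≤ L.height + 1) ∧
      IsBalanced L ∧ IsBalanced R := by
  simp only [IsBalanced, Set.mem_insert_iff, Set.mem_singleton_iff]
  refine and_congr_left fun _ => ?_
  omega

/-- No node of the tree has an imbalance less than `-1`. Unlike balance, this property passes from
`T` to the tree `Q` of a `SpineCut T P Q`. -/
def NotLeftHeavy : BinaryTree Unit → Prop
  | .nil => True
  | .node _ L R => L.height ≤ R.height + 1 ∧ NotLeftHeavy L ∧ NotLeftHeavy R

theorem IsBalanced.notLeftHeavy {T : BinaryTree Unit} (h : IsBalanced T) : NotLeftHeavy T := by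
  induction T with
  | nil => trivial
  | node _ L R hL hR =>
    obtain ⟨⟨hLR, -⟩, hbL, hbR⟩ := isBalanced_wedge.1 h
    exact ⟨hLR, hL hbL, hR hbR⟩

namespace SpineCut

variable {T P Q : BinaryTree Unit}

theorem height_left_lt (h : SpineCut T P Q) : P.height < T.height := by
  induction h with
  | root L R => simp only [BinaryTree.height]; omega
  | step R _ ih => simp only [BinaryTree.height]; omega

theorem height_right_le (h : SpineCut T P Q) : Q.height ≤ T.height := by
  induction h with
  | root L R => simp only [BinaryTree.height]; omega
  | step R _ ih => simp only [BinaryTree.height]; omega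

theorem isBalanced_left (h : SpineCut T P Q) (hT : IsBalanced T) : IsBalanced P := by
  induction h with
  | root L R => exact hT.2.1
  | step R _ ih => exact ih hT.2.1

theorem notLeftHeavy_left (h : SpineCut T P Q) (hT : NotLeftHeavy T) : NotLeftHeavy P := by
  induction h with
  | root L R => exact hT.2.1
  | step R _ ih => exact ih hT.2.1

theorem notLeftHeavy_right (h : SpineCut T P Q) (hT : NotLeftHeavy T) : NotLeftHeavy Q := by
  induction h with
  | root L R => exact hT.2.2
  | step R cut ih => exact ⟨cut.height_right_le.trans hT.1, ih hT.2.1, hT.2.2⟩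

theorem height_le_height_wedge (h : SpineCut T P Q) (hT : NotLeftHeavy T) :
    T.height ≤ (wedge P Q).height := by
  cases h with
  | root L R => rfl
  | step R cut =>
    have hLR := hT.1
    simp only [BinaryTree.height]
    omega

/-- If `P` has depth at least three in `T`, balance makes the last right subtree on the spine, and
hence `Q`, too high. -/
theorem eq_wedge_or_eq_wedge_wedge (h : SpineCut T P Q) (hT : IsBalanced T)
    (hQP : Q.height ≤ P.height + 1) :
    T = wedge P Q ∨ ∃ B C, T = wedge (wedge P B) C ∧ Q = wedge B C ∧
      C.height = P.height ∧ B.height ≤ P.height := by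
  cases h with
  | root L R => exact .inl rfl
  | step C cut =>
    obtain ⟨⟨hbal, -⟩, -, -⟩ := isBalanced_wedge.1 hT
    cases cut with
    | root =>
      simp only [BinaryTree.height] at hbal hQP
      exact .inr ⟨_, C, rfl, rfl, by omega, by omega⟩
    | step B cut =>
      have hlt := cut.height_left_lt
      simp only [BinaryTree.height] at hbal hQP
      omega

theorem isBalanced_right (h : SpineCut T P Q) (hT : IsBalanced T)
    (hQP : Q.height ≤ P.height + 1) : IsBalanced Q ∧ T.height = (wedge P Q).height := by
  obtain rfl | ⟨B, C, rfl, rfl, hC, hB⟩ := h.eq_wedge_or_eq_wedge_wedge hT hQP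
  · exact ⟨hT.2.2, rfl⟩
  · obtain ⟨⟨hPB, -⟩, -, hbB⟩ := isBalanced_wedge.1 hT.2.1
    refine ⟨isBalanced_wedge.2 ⟨by omega, hbB, hT.2.2⟩, ?_⟩
    simp only [BinaryTree.height]
    omega

end SpineCut

theorem TamariLE.height_le {T T' : BinaryTree Unit} (h : TamariLE T T') (hT : NotLeftHeavy T) :
    T.height ≤ T'.height := by
  induction T' generalizing T with
  | nil => rw [h.eq_nil_iff.2 rfl]
  | node _ L R ihL ihR =>
    obtain ⟨P, Q, cut, hP, hQ⟩ := h.exists_spineCut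
    calc T.height ≤ (wedge P Q).height := cut.height_le_height_wedge hT
      _ ≤ (wedge L R).height := Nat.succ_le_succ <| max_le_max
        (ihL hP (cut.notLeftHeavy_left hT)) (ihR hQ (cut.notLeftHeavy_right hT))

theorem TamariLE.height_eq {T T' : BinaryTree Unit} (h : TamariLE T T') (hT : IsBalanced T)
    (hT' : IsBalanced T') : T.height = T'.height := by
  induction T' generalizing T with
  | nil => rw [h.eq_nil_iff.2 rfl]
  | node _ L R ihL ihR =>
    obtain ⟨P, Q, cut, hP, hQ⟩ := h.exists_spineCut
    obtain ⟨⟨-, hRL⟩, hbL, hbR⟩ := isBalanced_wedge.1 hT'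
    have hPL := ihL hP (cut.isBalanced_left hT) hbL
    have hQR := hQ.height_le (cut.notLeftHeavy_right hT.notLeftHeavy)
    obtain ⟨hbQ, hheight⟩ := cut.isBalanced_right hT (by omega)
    rw [hheight, BinaryTree.height, BinaryTree.height, hPL, ihR hQ hbQ hbR]

theorem TamariLE.exists_spineCut_of_isBalanced {T L R : BinaryTree Unit}
    (h : TamariLE T (wedge L R)) (hT : IsBalanced T) (hLR : IsBalanced (wedge L R)) :
    ∃ P Q, SpineCut T P Q ∧ TamariLE P L ∧ TamariLE Q R ∧ Q.height ≤ P.height + 1 := by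
  obtain ⟨P, Q, cut, hP, hQ⟩ := h.exists_spineCut
  obtain ⟨⟨-, hRL⟩, hbL, -⟩ := isBalanced_wedge.1 hLR
  have hPL := hP.height_eq (cut.isBalanced_left hT) hbL
  have hQR := hQ.height_le (cut.notLeftHeavy_right hT.notLeftHeavy)
  exact ⟨P, Q, cut, hP, hQ, by omega⟩

theorem TamariLE.exists_eq_wedge_of_height_le {B C T : BinaryTree Unit}
    (h : TamariLE (wedge B C) T) (hBC : IsBalanced (wedge B C)) (hT : IsBalanced T)
    (hheight : B.height ≤ C.height) :
    ∃ B' C', T = wedge B' C' ∧ TamariLE B B' ∧ TamariLE C C' := by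
  cases T with
  | nil => simpa using h.eq_nil_iff.2 rfl
  | node _ B' C' =>
    obtain ⟨P, Q, cut, hP, hQ, hQP⟩ := h.exists_spineCut_of_isBalanced hBC hT
    obtain e | ⟨D, E, e, -, hE, -⟩ := cut.eq_wedge_or_eq_wedge_wedge hBC hQP
    · obtain ⟨-, rfl, rfl⟩ := BinaryTree.node.inj e
      exact ⟨B', C', rfl, hP, hQ⟩
    · obtain ⟨-, rfl, rfl⟩ := BinaryTree.node.inj e
      simp only [BinaryTree.height] at hheight
      omega

/-- Pairs `(T₀, T₁)` of binary trees, which stand for intervals `[T₀, T₁]`. -/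
abbrev TreePair := BinaryTree Unit × BinaryTree Unit

/-- `[I.1, I.2]` is a balanced binary tree interval, with any number of leaves. -/
structure IsBalancedInterval (I : TreePair) : Prop where
  isBalanced_fst : IsBalanced I.1
  isBalanced_snd : IsBalanced I.2
  tamariLE : TamariLE I.1 I.2

theorem IsBalancedInterval.height_eq {I : TreePair} (hI : IsBalancedInterval I) :
    I.1.height = I.2.height :=
  hI.tamariLE.height_eq hI.isBalanced_fst hI.isBalanced_snd

theorem isBalancedInterval_nil : IsBalancedInterval (.nil, .nil) :=
  ⟨trivial, trivial, .refl _⟩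

/-- The interval `[L₀ ∧ R₀, L₁ ∧ R₁]` built from `[L₀, L₁]` and `[R₀, R₁]`. -/
def wedgePair (L R : TreePair) : TreePair :=
  (wedge L.1 R.1, wedge L.2 R.2)

/-- The interval `[(A₀ ∧ B₀) ∧ C₀, A₁ ∧ (B₁ ∧ C₁)]` built from `[A₀, A₁]`, `[B₀, B₁]` and
`[C₀, C₁]`: its endpoints differ by a rotation at the root. -/
def rotatedWedge (A B C : TreePair) : TreePair :=
  (wedge (wedge A.1 B.1) C.1, wedge A.2 (wedge B.2 C.2))

theorem isBalancedInterval_wedgePair {L R : TreePair} (hL : IsBalancedInterval L)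
    (hR : IsBalancedInterval R) (hLR : L.1.height ≤ R.1.height + 1)
    (hRL : R.1.height ≤ L.1.height + 1) : IsBalancedInterval (wedgePair L R) where
  isBalanced_fst := isBalanced_wedge.2 ⟨⟨hLR, hRL⟩, hL.isBalanced_fst, hR.isBalanced_fst⟩
  isBalanced_snd := isBalanced_wedge.2
    ⟨hL.height_eq ▸ hR.height_eq ▸ ⟨hLR, hRL⟩, hL.isBalanced_snd, hR.isBalanced_snd⟩
  tamariLE := hL.tamariLE.wedge_mono hR.tamariLE

theorem isBalancedInterval_rotatedWedge {A B C : TreePair} (hA : IsBalancedInterval A)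
    (hB : IsBalancedInterval B) (hC : IsBalancedInterval C) (hCA : C.1.height = A.1.height)
    (hBA : B.1.height ≤ A.1.height) (hAB : A.1.height ≤ B.1.height + 1) :
    IsBalancedInterval (rotatedWedge A B C) := by
  have hAB' := isBalancedInterval_wedgePair hA hB hAB (by omega)
  have hBC' := isBalancedInterval_wedgePair hB hC (by omega) (by omega)
  have eA := hA.height_eq
  have eBC := hBC'.height_eq
  simp only [wedgePair, BinaryTree.height] at eBC
  refine ⟨isBalanced_wedge.2 ⟨?_, hAB'.isBalanced_fst, hC.isBalanced_fst⟩,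
    isBalanced_wedge.2 ⟨?_, hA.isBalanced_snd, hBC'.isBalanced_snd⟩,
    (TamariLE.rotate _ _ _).trans (hA.tamariLE.wedge_mono hBC'.tamariLE)⟩ <;>
  simp only [BinaryTree.height] <;> omega

theorem IsBalancedInterval.cases {I : TreePair} (hI : IsBalancedInterval I) :
    I = (.nil, .nil) ∨
    (∃ L R, IsBalancedInterval L ∧ IsBalancedInterval R ∧ I = wedgePair L R) ∨
    ∃ A B C, IsBalancedInterval A ∧ IsBalancedInterval B ∧ IsBalancedInterval C ∧
      C.1.height = A.1.height ∧ B.1.height ≤ A.1.height ∧ I = rotatedWedge A B C := by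
  obtain ⟨T₀, T₁⟩ := I
  obtain ⟨h₀, h₁, hle⟩ := hI
  dsimp only at h₀ h₁ hle
  cases T₁ with
  | nil => exact .inl (by rw [hle.eq_nil_iff.2 rfl])
  | node _ L₁ R₁ =>
    obtain ⟨P, Q, cut, hP, hQ, hQP⟩ := hle.exists_spineCut_of_isBalanced h₀ h₁
    have hbP := cut.isBalanced_left h₀
    have hbQ := (cut.isBalanced_right h₀ hQP).1
    obtain rfl | ⟨B, C, rfl, rfl, hC, hB⟩ := cut.eq_wedge_or_eq_wedge_wedge h₀ hQP
    · exact .inr (.inl ⟨(P, L₁), (Q, R₁), ⟨hbP, h₁.2.1, hP⟩, ⟨hbQ, h₁.2.2, hQ⟩, rfl⟩)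
    · obtain ⟨B₁, C₁, rfl, hB₁, hC₁⟩ :=
        hQ.exists_eq_wedge_of_height_le hbQ h₁.2.2 (by omega)
      exact .inr (.inr ⟨(P, L₁), (B, B₁), (C, C₁), ⟨hbP, h₁.2.1, hP⟩,
        ⟨hbQ.2.1, h₁.2.2.2.1, hB₁⟩, ⟨hbQ.2.2, h₁.2.2.2.2, hC₁⟩, hC, hB, rfl⟩)

theorem finite_setOf_height_le {α : Type*} [Finite α] (h : ℕ) :
    {T : BinaryTree α | T.height ≤ h}.Finite := by
  induction h with
  | zero =>
    refine (Set.finite_singleton BinaryTree.nil).subset fun T hT => ?_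
    cases T with
    | nil => rfl
    | node => simp [BinaryTree.height] at hT
  | succ h ih =>
    have hnodes := ((Set.finite_univ (α := α)).prod (ih.prod ih)).image
      fun p => BinaryTree.node p.1 p.2.1 p.2.2
    refine (hnodes.insert .nil).subset fun T hT => ?_
    cases T with
    | nil => exact .inl rfl
    | node a L R =>
      simp only [Set.mem_ofPred_eq, BinaryTree.height] at hT
      exact .inr ⟨(a, L, R), ⟨trivial, show L.height ≤ h by omega, show R.height ≤ h by omega⟩, rfl⟩

theorem finite_setOf_isBalancedInterval_height (k : ℕ) :
    {I : TreePair | IsBalancedInterval I ∧ I.1.height + 1 = k}.Finite := by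
  refine ((finite_setOf_height_le k).prod (finite_setOf_height_le k)).subset ?_
  rintro I ⟨hI, hk⟩
  have hheight := hI.height_eq
  exact ⟨show I.1.height ≤ k by omega, show I.2.height ≤ k by omega⟩

/-- The balanced intervals of trees with `k` levels of vertices, leaves included, i.e. of height
`k - 1`. Starting from the empty level `0` makes the recursion on `k` uniform. -/
noncomputable def levelIntervals (k : ℕ) : Finset TreePair :=
  (finite_setOf_isBalancedInterval_height k).toFinset

theorem mem_levelIntervals {k : ℕ} {I : TreePair} :
    I ∈ levelIntervals k ↔ IsBalancedInterval I ∧ I.1.height + 1 = k :=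
  Set.Finite.mem_toFinset _

theorem levelIntervals_zero : levelIntervals 0 = ∅ := by
  ext I
  simp [mem_levelIntervals]

theorem levelIntervals_one : levelIntervals 1 = {(.nil, .nil)} := by
  ext I
  rw [mem_levelIntervals, Finset.mem_singleton]
  constructor
  · rintro ⟨hI, hheight⟩
    obtain rfl | ⟨L, R, -, -, rfl⟩ | ⟨A, B, C, -, -, -, -, -, rfl⟩ := hI.cases
    · rfl
    · simp [wedgePair, BinaryTree.height] at hheight
    · simp [rotatedWedge, BinaryTree.height] at hheight
  · rintro rfl
    exact ⟨isBalancedInterval_nil, rfl⟩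

theorem disjoint_levelIntervals {k l : ℕ} (h : k ≠ l) :
    Disjoint (levelIntervals k) (levelIntervals l) := by
  refine Finset.disjoint_left.2 fun I hk hl => h ?_
  rw [← (mem_levelIntervals.1 hk).2, (mem_levelIntervals.1 hl).2]

/-- The pairs `(L, R)` for which `wedgePair L R` is a balanced interval with `k + 2` levels. -/
noncomputable def levelPairs (k : ℕ) : Finset (TreePair × TreePair) :=
  levelIntervals (k + 1) ×ˢ levelIntervals (k + 1) ∪ levelIntervals (k + 1) ×ˢ levelIntervals k ∪
    levelIntervals k ×ˢ levelIntervals (k + 1)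

/-- The triples `(A, B, C)` for which `rotatedWedge A B C` is a balanced interval with `k + 2`
levels. The truncation `0 - 1 = 0` is harmless since there are no intervals on level `0`. -/
noncomputable def levelTriples (k : ℕ) : Finset (TreePair × TreePair × TreePair) :=
  levelIntervals k ×ˢ (levelIntervals k ∪ levelIntervals (k - 1)) ×ˢ levelIntervals k

theorem mem_levelPairs {k : ℕ} {p : TreePair × TreePair} :
    p ∈ levelPairs k ↔ IsBalancedInterval p.1 ∧ IsBalancedInterval p.2 ∧
      wedgePair p.1 p.2 ∈ levelIntervals (k + 2) := by
  obtain ⟨L, R⟩ := p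
  have hheight : (wedgePair L R).1.height = max L.1.height R.1.height + 1 := rfl
  simp only [levelPairs, Finset.mem_union, Finset.mem_product, mem_levelIntervals, hheight]
  constructor
  · rintro ((⟨⟨hL, hLk⟩, hR, hRk⟩ | ⟨⟨hL, hLk⟩, hR, hRk⟩) | ⟨⟨hL, hLk⟩, hR, hRk⟩) <;>
    exact ⟨hL, hR, isBalancedInterval_wedgePair hL hR (by omega) (by omega), by omega⟩
  · rintro ⟨hL, hR, hI, hk⟩
    obtain ⟨⟨hLR, hRL⟩, -, -⟩ := isBalanced_wedge.1 hI.isBalanced_fst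
    simp only [hL, hR, true_and]
    omega

theorem mem_levelTriples {k : ℕ} {p : TreePair × TreePair × TreePair} :
    p ∈ levelTriples k ↔
      IsBalancedInterval p.1 ∧ IsBalancedInterval p.2.1 ∧ IsBalancedInterval p.2.2 ∧
        p.2.2.1.height = p.1.1.height ∧ p.2.1.1.height ≤ p.1.1.height ∧
        rotatedWedge p.1 p.2.1 p.2.2 ∈ levelIntervals (k + 2) := by
  obtain ⟨A, B, C⟩ := p
  have hheight : (rotatedWedge A B C).1.height =
    max (max A.1.height B.1.height + 1) C.1.height + 1 := rfl
  simp only [levelTriples, Finset.mem_union, Finset.mem_product, mem_levelIntervals, hheight]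
  constructor
  · rintro ⟨⟨hA, hAk⟩, ⟨hB, hBk⟩ | ⟨hB, hBk⟩, hC, hCk⟩ <;>
    exact ⟨hA, hB, hC, by omega, by omega, isBalancedInterval_rotatedWedge hA hB hC (by omega)
      (by omega) (by omega), by omega⟩
  · rintro ⟨hA, hB, hC, hCA, hBA, hI, hk⟩
    obtain ⟨⟨hAB, -⟩, -, -⟩ := isBalanced_wedge.1 hI.isBalanced_fst.2.1
    simp only [hA, hB, hC, true_and]
    omega

theorem levelIntervals_add_two (k : ℕ) :
    levelIntervals (k + 2) = (levelPairs k).image (fun p => wedgePair p.1 p.2) ∪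
      (levelTriples k).image fun p => rotatedWedge p.1 p.2.1 p.2.2 := by
  ext I
  simp only [Finset.mem_union, Finset.mem_image, mem_levelPairs, mem_levelTriples]
  constructor
  · intro hI
    obtain ⟨hbal, hheight⟩ := mem_levelIntervals.1 hI
    obtain rfl | ⟨L, R, hL, hR, rfl⟩ | ⟨A, B, C, hA, hB, hC, hCA, hBA, rfl⟩ := hbal.cases
    · simp [BinaryTree.height] at hheight
    · exact .inl ⟨(L, R), ⟨hL, hR, hI⟩, rfl⟩
    · exact .inr ⟨(A, B, C), ⟨hA, hB, hC, hCA, hBA, hI⟩, rfl⟩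
  · rintro (⟨p, ⟨-, -, hI⟩, rfl⟩ | ⟨p, ⟨-, -, -, -, -, hI⟩, rfl⟩) <;> exact hI

theorem wedgePair_injective : Function.Injective fun p : TreePair × TreePair =>
    wedgePair p.1 p.2 := by
  rintro ⟨⟨L₀, L₁⟩, R₀, R₁⟩ ⟨⟨L₀', L₁'⟩, R₀', R₁'⟩ h
  simp only [wedgePair, Prod.mk.injEq, BinaryTree.node.injEq] at h ⊢
  tauto

theorem rotatedWedge_injective : Function.Injective fun p : TreePair × TreePair × TreePair =>
    rotatedWedge p.1 p.2.1 p.2.2 := by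
  rintro ⟨⟨A₀, A₁⟩, ⟨B₀, B₁⟩, C₀, C₁⟩ ⟨⟨A₀', A₁'⟩, ⟨B₀', B₁'⟩, C₀', C₁'⟩ h
  simp only [rotatedWedge, Prod.mk.injEq, BinaryTree.node.injEq] at h ⊢
  tauto

theorem wedgePair_ne_rotatedWedge {L R A B C : TreePair} (hL : L.1.height = L.2.height)
    (hA : A.1.height = A.2.height) : wedgePair L R ≠ rotatedWedge A B C := by
  intro h
  obtain ⟨⟨-, hL₀, -⟩, -, hL₁, -⟩ := by
    simpa only [wedgePair, rotatedWedge, Prod.mk.injEq, BinaryTree.node.injEq] using h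
  rw [hL₀, hL₁, ← hA] at hL
  simp only [BinaryTree.height] at hL
  omega

theorem disjoint_image_wedgePair_image_rotatedWedge (k : ℕ) :
    Disjoint ((levelPairs k).image fun p => wedgePair p.1 p.2)
      ((levelTriples k).image fun p => rotatedWedge p.1 p.2.1 p.2.2) := by
  simp only [Finset.disjoint_left, Finset.mem_image, mem_levelPairs, mem_levelTriples]
  rintro _ ⟨p, ⟨hL, -⟩, rfl⟩ ⟨q, ⟨hA, -⟩, h⟩
  exact wedgePair_ne_rotatedWedge hL.height_eq hA.height_eq h.symm

section SizeSeries

variable {α β : Type*} (R : Type*) [CommSemiring R] (size : α → ℕ)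

/-- The generating series of the finite set `s` by `size`. -/
noncomputable def sizeSeries (s : Finset α) : PowerSeries R :=
  ∑ a ∈ s, PowerSeries.X ^ size a

theorem coeff_sizeSeries (s : Finset α) (n : ℕ) :
    PowerSeries.coeff n (sizeSeries R size s) = (s.filter fun a => size a = n).card := by
  simp only [sizeSeries, map_sum, PowerSeries.coeff_X_pow, eq_comm, Finset.sum_boole]

theorem sizeSeries_union [DecidableEq α] {s t : Finset α} (h : Disjoint s t) :
    sizeSeries R size (s ∪ t) = sizeSeries R size s + sizeSeries R size t :=
  Finset.sum_union h

theorem sizeSeries_image [DecidableEq α] {φ : β → α} (hφ : Function.Injective φ) (s : Finset β) :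
    sizeSeries R size (s.image φ) = sizeSeries R (size ∘ φ) s :=
  Finset.sum_image hφ.injOn

theorem sizeSeries_product (size' : β → ℕ) (s : Finset α) (t : Finset β) :
    sizeSeries R (fun p => size p.1 + size' p.2) (s ×ˢ t) =
      sizeSeries R size s * sizeSeries R size' t := by
  simp only [sizeSeries, pow_add, Finset.sum_product, Finset.sum_mul_sum]

theorem le_order_sizeSeries {s : Finset α} {n : ℕ} (hs : ∀ a ∈ s, n ≤ size a) :
    (n : ℕ∞) ≤ (sizeSeries R size s).order := by
  refine PowerSeries.nat_le_order _ n fun i hi => ?_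
  rw [coeff_sizeSeries, Finset.filter_false_of_mem fun a ha => (hi.trans_le (hs a ha)).ne',
    Finset.card_empty, Nat.cast_zero]

end SizeSeries

/-- The generating series, by number of leaves, of the balanced intervals with `k` levels. -/
noncomputable def levelSeries (k : ℕ) : PowerSeries ℤ :=
  sizeSeries ℤ (fun I : TreePair => I.1.numLeaves) (levelIntervals k)

theorem levelSeries_zero : levelSeries 0 = 0 := by
  rw [levelSeries, levelIntervals_zero, sizeSeries, Finset.sum_empty]

theorem levelSeries_one : levelSeries 1 = PowerSeries.X := by
  rw [levelSeries, levelIntervals_one, sizeSeries, Finset.sum_singleton, BinaryTree.numLeaves,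
    pow_one]

theorem sizeSeries_levelPairs (k : ℕ) :
    sizeSeries ℤ (fun p => p.1.1.numLeaves + p.2.1.numLeaves) (levelPairs k) =
      levelSeries (k + 1) ^ 2 + 2 * levelSeries (k + 1) * levelSeries k := by
  have hk : Disjoint (levelIntervals (k + 1)) (levelIntervals k) :=
    disjoint_levelIntervals k.succ_ne_self
  rw [levelPairs, sizeSeries_union, sizeSeries_union]
  · simp only [sizeSeries_product ℤ (fun I : TreePair => I.1.numLeaves)
      (fun I : TreePair => I.1.numLeaves), levelSeries]
    ring
  · exact Finset.disjoint_product.2 (.inr hk)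
  · exact Finset.disjoint_union_left.2
      ⟨Finset.disjoint_product.2 (.inl hk), Finset.disjoint_product.2 (.inl hk)⟩

theorem sizeSeries_levelTriples (k : ℕ) :
    sizeSeries ℤ (fun p => p.1.1.numLeaves + (p.2.1.1.numLeaves + p.2.2.1.numLeaves))
        (levelTriples k) =
      levelSeries k * ((levelSeries k + levelSeries (k - 1)) * levelSeries k) := by
  have hunion : sizeSeries ℤ (fun I : TreePair => I.1.numLeaves)
      (levelIntervals k ∪ levelIntervals (k - 1)) = levelSeries k + levelSeries (k - 1) := by
    refine sizeSeries_union _ _ ?_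
    cases k with
    | zero => exact levelIntervals_zero ▸ Finset.disjoint_empty_left _
    | succ k => exact disjoint_levelIntervals k.succ_ne_self
  rw [levelTriples, sizeSeries_product ℤ (fun I : TreePair => I.1.numLeaves)
    (fun p : TreePair × TreePair => p.1.1.numLeaves + p.2.1.numLeaves),
    sizeSeries_product ℤ (fun I : TreePair => I.1.numLeaves)
    (fun I : TreePair => I.1.numLeaves), hunion]
  rfl

theorem levelSeries_add_two (k : ℕ) :
    levelSeries (k + 2) = levelSeries (k + 1) ^ 2 + 2 * levelSeries (k + 1) * levelSeries k +
      levelSeries k * (levelSeries k ^ 2 + levelSeries k * levelSeries (k - 1)) := by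
  rw [levelSeries, levelIntervals_add_two,
    sizeSeries_union _ _ (disjoint_image_wedgePair_image_rotatedWedge k),
    sizeSeries_image _ _ wedgePair_injective, sizeSeries_image _ _ rotatedWedge_injective]
  have hpairs : (fun I : TreePair => I.1.numLeaves) ∘
      (fun p : TreePair × TreePair => wedgePair p.1 p.2) =
      fun p => p.1.1.numLeaves + p.2.1.numLeaves := rfl
  have htriples : (fun I : TreePair => I.1.numLeaves) ∘
      (fun p : TreePair × TreePair × TreePair => rotatedWedge p.1 p.2.1 p.2.2) =
      fun p => p.1.1.numLeaves + (p.2.1.1.numLeaves + p.2.2.1.numLeaves) :=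
    funext fun p => add_assoc _ _ _
  rw [hpairs, htriples, sizeSeries_levelPairs, sizeSeries_levelTriples]
  ring

theorem le_order_levelSeries (k : ℕ) : (k : ℕ∞) ≤ (levelSeries k).order := by
  refine le_order_sizeSeries _ _ fun I hI => ?_
  rw [← (mem_levelIntervals.1 hI).2, I.1.numLeaves_eq_numNodes_succ]
  exact Nat.succ_le_succ I.1.height_le_numNodes

/-- The substitution obtained from `specSubst` by substituting `h` times into `biSubst`. The value
of `z` counts the pairs of balanced intervals on the levels `h` and `h`, or `h` and `h - 1`. -/
noncomputable def levelSubst (h : ℕ) : Fin 3 → PowerSeries ℤ :=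
  ![levelSeries (h + 1), levelSeries h, levelSeries h ^ 2 + levelSeries h * levelSeries (h - 1)]

theorem levelSubst_zero : levelSubst 0 = specSubst := by
  simp [levelSubst, specSubst, levelSeries_zero, levelSeries_one]

theorem le_order_levelSubst (h : ℕ) (i : Fin 3) :
    (h : ℕ∞) ≤ MvPowerSeries.order (levelSubst h i) := by
  rw [← PowerSeries.order_eq_order]
  have hh := le_order_levelSeries h
  fin_cases i
  · exact le_trans (by exact_mod_cast h.le_succ) (le_order_levelSeries (h + 1))
  · exact hh
  · refine le_trans ?_ (PowerSeries.min_order_le_order_add _ _)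
    rw [sq]
    exact le_min ((hh.trans le_self_add).trans (PowerSeries.le_order_mul _ _))
      ((hh.trans le_self_add).trans (PowerSeries.le_order_mul _ _))

theorem constantCoeff_levelSeries (k : ℕ) : PowerSeries.constantCoeff (levelSeries k) = 0 := by
  simp [levelSeries, sizeSeries, fun T : BinaryTree Unit => T.numLeaves_pos.ne']

theorem hasSubst_levelSubst (h : ℕ) : MvPowerSeries.HasSubst (levelSubst h) := by
  have hconst := constantCoeff_levelSeries
  refine MvPowerSeries.hasSubst_of_constantCoeff_zero fun i => ?_
  change PowerSeries.constantCoeff (levelSubst h i) = 0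
  fin_cases i <;> simp [levelSubst, hconst]

theorem subst_levelSubst_biSubst (h : ℕ) (i : Fin 3) :
    MvPowerSeries.subst (levelSubst h) (biSubst i) = levelSubst (h + 1) i := by
  have hs := hasSubst_levelSubst h
  rw [← MvPowerSeries.coe_substAlgHom hs]
  fin_cases i
  · simp only [biSubst, Fin.zero_eta, Matrix.cons_val_zero, map_add, map_mul, map_pow, map_ofNat,
      MvPowerSeries.substAlgHom_X hs]
    exact (levelSeries_add_two h).symm
  · simp only [biSubst, Fin.mk_one, Matrix.cons_val_one, Matrix.cons_val_zero,
      MvPowerSeries.substAlgHom_X hs]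
    rfl
  · simp only [biSubst, Fin.reduceFinMk, Matrix.cons_val, map_add, map_mul, map_pow,
      MvPowerSeries.substAlgHom_X hs]
    rfl

theorem balancedIntervals_eq_coe_biUnion (n : ℕ) :
    balancedIntervals n = (Finset.range (n + 1)).biUnion fun h =>
      (levelIntervals (h + 1)).filter fun I => I.1.numLeaves = n := by
  ext I
  simp only [balancedIntervals, Set.mem_ofPred_eq, SetLike.mem_coe, Finset.mem_biUnion,
    Finset.mem_filter, mem_levelIntervals, Finset.mem_range, Nat.succ_inj]
  constructor
  · rintro ⟨hn, -, h₀, h₁, hle⟩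
    refine ⟨I.1.height, ?_, ⟨⟨h₀, h₁, hle⟩, rfl⟩, hn⟩
    rw [← hn, I.1.numLeaves_eq_numNodes_succ]
    exact I.1.height_le_numNodes.trans_lt (by omega)
  · rintro ⟨-, -, ⟨hI, -⟩, hn⟩
    exact ⟨hn, hI.tamariLE.numLeaves_eq ▸ hn, hI.isBalanced_fst, hI.isBalanced_snd, hI.tamariLE⟩

theorem finite_balancedIntervals (n : ℕ) : (balancedIntervals n).Finite :=
  balancedIntervals_eq_coe_biUnion n ▸ Finset.finite_toSet _

theorem ncard_balancedIntervals (n : ℕ) : ((balancedIntervals n).ncard : ℤ) =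
    ∑ h ∈ Finset.range (n + 1), PowerSeries.coeff n (levelSeries (h + 1)) := by
  rw [balancedIntervals_eq_coe_biUnion, Set.ncard_coe_finset, Finset.card_biUnion]
  · simp only [levelSeries, coeff_sizeSeries, Nat.cast_sum]
  · intro h _ h' _ hne
    exact Finset.disjoint_filter_filter (disjoint_levelIntervals (Nat.succ_injective.ne hne))

theorem le_weightedOrder_X_mul_X {σ R : Type*} [Semiring R] (w : σ → ℕ) (i j : σ) :
    ((w i + w j : ℕ) : ℕ∞) ≤
      (MvPowerSeries.X i * MvPowerSeries.X j : MvPowerSeries σ R).weightedOrder w := by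
  cases subsingleton_or_nontrivial R
  · exact MvPowerSeries.nat_le_weightedOrder w fun _ _ => Subsingleton.elim _ _
  · refine le_trans (le_of_eq ?_) (MvPowerSeries.le_weightedOrder_mul w)
    simp [MvPowerSeries.X_def, MvPowerSeries.weightedOrder_monomial_of_ne_zero,
      Finsupp.weight_single]

/-- Weights for which `biSubst` raises weighted orders. The total degree does not serve, since
`y` is replaced by `x`. -/
def biWeight : Fin 3 → ℕ := ![2, 1, 2]

theorem biWeight_add_one_le_weightedOrder_biSubst (i : Fin 3) :
    ((biWeight i + 1 : ℕ) : ℕ∞) ≤ (biSubst i).weightedOrder biWeight := by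
  have le_X_mul_X {i j : Fin 3} {n : ℕ} (hn : n ≤ biWeight i + biWeight j) :
      (n : ℕ∞) ≤ (MvPowerSeries.X i * MvPowerSeries.X j :
        MvPowerSeries (Fin 3) ℤ).weightedOrder biWeight :=
    le_trans (by exact_mod_cast hn) (le_weightedOrder_X_mul_X biWeight i j)
  have le_add {f g : MvPowerSeries (Fin 3) ℤ} {n : ℕ∞} (hf : n ≤ f.weightedOrder biWeight)
      (hg : n ≤ g.weightedOrder biWeight) : n ≤ (f + g).weightedOrder biWeight :=
    (le_min hf hg).trans (MvPowerSeries.min_weightedOrder_le_add _)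
  fin_cases i
  · simp only [biSubst, Fin.zero_eta, Matrix.cons_val_zero, sq, two_mul, add_mul]
    exact le_add (le_add (le_X_mul_X (by decide)) (le_add (le_X_mul_X (by decide))
      (le_X_mul_X (by decide)))) (le_X_mul_X (by decide))
  · simp [biSubst, MvPowerSeries.X_def, MvPowerSeries.weightedOrder_monomial_of_ne_zero,
      Finsupp.weight_single, biWeight]
  · simp only [biSubst, Fin.reduceFinMk, Matrix.cons_val, sq]
    exact le_add (le_X_mul_X (by decide)) (le_X_mul_X (by decide))

theorem existsUnique_isBiSeries : ∃! S, IsBiSeries S :=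
  existsUnique_eq_add_subst hasSubst_biSubst biWeight_add_one_le_weightedOrder_biSubst
    (MvPowerSeries.constantCoeff_X 0)

theorem IsBiSeries.coeff_subst_specSubst {S : MvPowerSeries (Fin 3) ℤ} (hS : IsBiSeries S)
    (n : ℕ) : PowerSeries.coeff n (MvPowerSeries.subst specSubst S : PowerSeries ℤ) =
      ∑ h ∈ Finset.range (n + 1), PowerSeries.coeff n (levelSeries (h + 1)) := by
  have hsum := coeff_subst_eq_sum_coeff_subst hasSubst_biSubst hasSubst_levelSubst
    subst_levelSubst_biSubst le_order_levelSubst hS.1 hS.2 (Finsupp.single () n)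
  simp only [Finsupp.degree_single, MvPowerSeries.subst_X (hasSubst_levelSubst _),
    levelSubst_zero] at hsum
  exact hsum

theorem mainTheorem5 :
    (∀ n : ℕ, (balancedIntervals n).Finite) ∧
    (∃! S : MvPowerSeries (Fin 3) ℤ, IsBiSeries S) ∧
    ∀ S : MvPowerSeries (Fin 3) ℤ, IsBiSeries S →
      (MvPowerSeries.subst specSubst S : PowerSeries ℤ) = balancedIntervalSeries := by
  refine ⟨finite_balancedIntervals, existsUnique_isBiSeries, fun S hS => ?_⟩
  ext n
  rw [hS.coeff_subst_specSubst, balancedIntervalSeries, PowerSeries.coeff_mk,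
    ncard_balancedIntervals]
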